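/- Let $E$ be a Polish space with a metric $d$ inducing its topology (e.g. a complete separable metric space $(E,d)$), equipped with its Borel $\sigma$-algebra; write $B(z,\varepsilon)=\{y\in E: d(y,z)<\varepsilon\}$, and let $\mathcal M(E)$ be the set of Borel probability measures on $E$. Let $\{P_t\}_{t\ge 0}$ be a Markov-Feller semigroup on $E$: each $P_t(x,dy)$ is a Markov transition kernel on $E$, $P_0(x,\cdot)=\delta_x$, $P_{s+t}(x,A)=\int_E P_t(y,A)\,P_s(x,dy)$ for all $s,t\ge0$, the function $P_tf(x)=\int_E f(y)\,P_t(x,dy)$ is continuous for every bounded continuous $f:E\to\mathbb R$ and every $t\ge0$, and $t\mapsto P_t(x,A)$ is measurable for every $x\in E$ and every Borel set $A$. Put $P_t^*\mu(A)=\int_E P_t(x,A)\,\mu(dx)$ for $\mu\in\mathcal M(E)$, and, for $t>0$, $$Q_t(x,A)=\frac1t\int_0^t P_s(x,A)\,ds .$$ **Theorem 2.2.** Suppose that for every $x\in E$ the family of probability measures $\{Q_t(x,\cdot)\}_{t>0}$ is tight. Then the following two statements are equivalent. 1. The semigroup is asymptotically stable with a unique invariant measure: there is $\mu\in\mathcal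 M(E)$ such that $P_t^*\nu\to\mu$ weakly as $t\to\infty$ for every $\nu\in\mathcal M(E)$, and $\mu$ is the unique element of $\mathcal M(E)$ with $P_t^*\mu=\mu$ for all $t\ge0$. 2. There exists $z\in E$ such that - $\{P_t\}$ is eventually continuous at $z$: for every bounded Lipschitz function $f:E\to\mathbb R$, $$\limsup_{x\to z}\ \limsup_{t\to\infty}\ |P_tf(x)-P_tf(z)|=0;$$ - $\displaystyle\limsup_{t\to\infty}Q_t(x,B(z,\varepsilon))>0$ for all $x\in E$ and all $\varepsilon>0$; - $\displaystyle\liminf_{t\to\infty}P_t(z,B(z,\varepsilon))>0$ for all $\varepsilon>0$. -/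

import Mathlib

open MeasureTheory ProbabilityTheory Filter Topology
open scoped NNReal ENNReal BoundedContinuousFunction

/-- A (time-homogeneous) Markov-Feller semigroup on `E`, given by its transition probabilities
`P_t(x, A) = kernel t x A`. Measurability in time is what makes the time averages
`(1/t) ∫₀ᵗ P_s(x, A) ds` meaningful; no continuity in time is required. -/
structure MarkovFellerSemigroup (E : Type*) [TopologicalSpace E] [MeasurableSpace E] where
  /-- The transition kernels `P_t(x, dy)`. -/
  kernel : ℝ≥0 → Kernel E E
  isMarkovKernel : ∀ t, IsMarkovKernel (kernel t)
  kernel_zero : kernel 0 = Kernel.id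
  /-- Chapman-Kolmogorov: `P_{s+t}(x, A) = ∫ P_t(y, A) P_s(x, dy)`. -/
  kernel_add : ∀ s t, kernel (s + t) = kernel t ∘ₖ kernel s
  /-- Feller property: `P_t` maps bounded continuous functions to continuous functions. -/
  feller : ∀ (t : ℝ≥0) (f : E →ᵇ ℝ), Continuous fun x => ∫ y, f y ∂(kernel t x)
  /-- For all `x` and measurable `A`, the function `t ↦ P_t(x, A)` is measurable. -/
  measurable_time : ∀ (x : E) (A : Set E), MeasurableSet A → Measurable fun t => kernel t x A

namespace MarkovFellerSemigroup

section Measurable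

variable {E : Type*} [TopologicalSpace E] [MeasurableSpace E]

instance instIsMarkovKernel (P : MarkovFellerSemigroup E) (t : ℝ≥0) :
    IsMarkovKernel (P.kernel t) :=
  P.isMarkovKernel t

/-- The function `P_t f(x) = ∫ f(y) P_t(x, dy)`. -/
noncomputable def apply (P : MarkovFellerSemigroup E) (t : ℝ≥0) (f : E → ℝ) (x : E) : ℝ :=
  ∫ y, f y ∂(P.kernel t x)

/-- The dual semigroup on probability measures, `P_t^* μ (A) = ∫ P_t(x, A) μ(dx)`. -/
noncomputable def dual (P : MarkovFellerSemigroup E) (t : ℝ≥0) (μ : ProbabilityMeasure E) :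
    ProbabilityMeasure E :=
  ⟨(μ : Measure E).bind (P.kernel t), inferInstance⟩

/-- The time average `Q_t(x, ·) = (1/t) ∫₀ᵗ P_s(x, ·) ds`, meaningful for `t > 0`. -/
noncomputable def cesaro (P : MarkovFellerSemigroup E) (t : ℝ≥0) (x : E) : Measure E :=
  (t : ℝ≥0∞)⁻¹ •
    (volume.restrict (Set.Ioc (0 : ℝ) t)).bind (fun s : ℝ => P.kernel s.toNNReal x)

/-- The set `𝒯` of all `x` such that the family `Q_t(x, ·)`, `t > 0`, is tight. -/
def tightPoints (P : MarkovFellerSemigroup E) : Set E :=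
  {x | IsTightMeasureSet {ν : Measure E | ∃ t : ℝ≥0, 0 < t ∧ ν = P.cesaro t x}}

/-- `μ` is an invariant probability measure: `P_t^* μ = μ` for all `t`. -/
def IsInvariant (P : MarkovFellerSemigroup E) (μ : ProbabilityMeasure E) : Prop :=
  ∀ t, P.dual t μ = μ

/-- The semigroup is asymptotically stable with limit `μ`: for every probability measure `ν`,
`P_t^* ν` converges weakly to `μ` as `t → ∞`. -/
def IsAsymptoticallyStableWith [OpensMeasurableSpace E] (P : MarkovFellerSemigroup E)
    (μ : ProbabilityMeasure E) : Prop :=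
  ∀ ν : ProbabilityMeasure E, Tendsto (fun t => P.dual t ν) atTop (𝓝 μ)

theorem measurable_kernel_toNNReal (P : MarkovFellerSemigroup E) (x : E) :
    Measurable fun s : ℝ => P.kernel s.toNNReal x :=
  Measure.measurable_of_measurable_coe _ fun A hA =>
    (P.measurable_time x A hA).comp measurable_real_toNNReal

theorem cesaro_apply (P : MarkovFellerSemigroup E) (t : ℝ≥0) (x : E) {A : Set E}
    (hA : MeasurableSet A) :
    P.cesaro t x A =
      (t : ℝ≥0∞)⁻¹ * ∫⁻ s in Set.Ioc (0 : ℝ) t, P.kernel s.toNNReal x A := by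
  simp [cesaro, Measure.bind_apply hA (P.measurable_kernel_toNNReal x).aemeasurable]

theorem isProbabilityMeasure_cesaro (P : MarkovFellerSemigroup E) {t : ℝ≥0} (ht : 0 < t)
    (x : E) : IsProbabilityMeasure (P.cesaro t x) := by
  refine ⟨?_⟩
  rw [P.cesaro_apply t x MeasurableSet.univ]
  simp [ENNReal.inv_mul_cancel, ht.ne']

end Measurable

section Metric

variable {E : Type*} [MetricSpace E] [MeasurableSpace E]

/-- Eventual continuity at `z`: for every bounded Lipschitz function `f`,
`limsup_{x → z} limsup_{t → ∞} |P_t f(x) - P_t f(z)| = 0`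
(the upper limits are taken in `[0, ∞]`). -/
def EventuallyContinuousAt (P : MarkovFellerSemigroup E) (z : E) : Prop :=
  ∀ f : E → ℝ, (∃ K : ℝ≥0, LipschitzWith K f) → (∃ C : ℝ, ∀ x, |f x| ≤ C) →
    limsup (fun x => limsup (fun t => ENNReal.ofReal |P.apply t f x - P.apply t f z|) atTop)
      (𝓝 z) = 0

end Metric

end MarkovFellerSemigroup

/-!
The implication from stability is soft: if `P_t^* ν → μ` for all `ν`, then `P_t f(x) → ∫ f dμ` for
every `x`, which gives eventual continuity at every point, and any `z` in the support of `μ`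
satisfies both lower bounds by the portmanteau theorem.

For the converse, fix a bounded Lipschitz `f` and measure the oscillation
`limsup_t |P_t f(x) - P_t f(y)|`, which by eventual continuity is small for `x, y` near `z`. It
suffices that it vanishes for all `x, y`: integrating against `ν ⊗ μ` with `μ` invariant then gives
`P_t^* ν → μ` (`IsInvariant.isAsymptoticallyStableWith`). The argument runs two independent copies
of the process, so that both must be brought near `z` at the same time. This is possible because,
for every `x` and `ε`, `P_t(x, B(z, ε))` is bounded below for all large `t`
(`EventuallyContinuousAt.exists_le_kernel_real`): eventual continuity transfers the lower bound for
`P_t(z, B(z, ε))` to a neighbourhood of `z`, and the time averages show that `x` reaches it.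

* Uniqueness of the invariant measure (`IsInvariant.eq_of_eventuallyContinuousAt`). Along integer
  times the oscillation is a bounded subharmonic function of the pair. Under a product `μ ⊗ ν` of
  invariant measures such a function is constant along transitions
  (`Kernel.Invariant.ae_ae_eq_of_subharmonic`). As the pair gets close to `(z, z)` with positive
  probability, the oscillation vanishes almost everywhere, whence `∫ f dμ = ∫ f dν`.
* Uniform recurrence (`EventuallyContinuousAt.exists_forall_le_kernel_real`). By tightness and the
  Krylov-Bogoliubov argument the averages `Q_t(x, ·)` have a limit point, which is invariant, hence
  the same for all `x`. This makes the lower bound on `P_t(x, B(z, ε))` for large `t` independent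
  of `x`.
* Contraction (`eventually_abs_apply_sub_apply_le`). If `c` is the supremum of the oscillation over
  all pairs, and two copies meet in a ball where it is at most `η` with probability at least `q`,
  then `c ≤ q η + (1 - q) c`, so `c ≤ η`. This step uses real times, as no continuity in time is
  available to interpolate between integers.
-/

/-! ### Integrals against Markov kernels -/

section KernelLemmas

variable {α β : Type*} [MeasurableSpace α] [MeasurableSpace β]

theorem MeasureTheory.Integrable.of_abs_le {μ : Measure α} [IsFiniteMeasure μ] {f : α → ℝ}
    (hf : Measurable f) {C : ℝ} (hC : ∀ x, |f x| ≤ C) : Integrable f μ :=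
  Integrable.of_bound hf.aestronglyMeasurable C (Eventually.of_forall hC)

theorem MeasureTheory.abs_integral_le_of_abs_le {μ : Measure α} [IsProbabilityMeasure μ]
    {f : α → ℝ} {C : ℝ} (hC : ∀ x, |f x| ≤ C) : |∫ x, f x ∂μ| ≤ C := by
  simpa using norm_integral_le_of_norm_le_const (μ := μ) (f := f) (Eventually.of_forall hC)

theorem ProbabilityTheory.Kernel.integral_bind_of_abs_le (κ : Kernel α β) [IsMarkovKernel κ]
    (μ : Measure α) [IsFiniteMeasure μ] {f : β → ℝ} (hf : Measurable f) {C : ℝ}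
    (hC : ∀ y, |f y| ≤ C) : ∫ y, f y ∂(μ.bind κ) = ∫ x, ∫ y, f y ∂(κ x) ∂μ := by
  have hint : Integrable f ((κ ∘ₖ Kernel.const Unit μ) ()) := .of_abs_le hf hC
  rw [Measure.comp_eq_comp_const_apply, Kernel.integral_comp hint, Kernel.const_apply]

theorem ProbabilityTheory.Kernel.measurable_integral_of_measurable (κ : Kernel α β)
    [IsSFiniteKernel κ] {f : β → ℝ} (hf : Measurable f) :
    Measurable fun x => ∫ y, f y ∂(κ x) :=
  (hf.stronglyMeasurable.integral_kernel (κ := κ)).measurable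

/-- A bounded nonnegative function that is subharmonic for a Markov kernel `κ` is constant along
the transitions of `κ`, almost surely under every invariant probability measure: expanding the
square bounds the integral of `(F v - F u) ^ 2` by that of `κ (F ^ 2) - F ^ 2`, which vanishes. -/
theorem ProbabilityTheory.Kernel.Invariant.ae_ae_eq_of_subharmonic {κ : Kernel α α}
    [IsMarkovKernel κ] {ρ : Measure α} [IsProbabilityMeasure ρ] (hρ : κ.Invariant ρ)
    {F : α → ℝ} (hF : Measurable F) (h0 : ∀ x, 0 ≤ F x) {C : ℝ} (hC : ∀ x, F x ≤ C)
    (hsub : ∀ x, F x ≤ ∫ y, F y ∂(κ x)) : ∀ᵐ u ∂ρ, ∀ᵐ v ∂(κ u), F v = F u := by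
  have hab : ∀ x, |F x| ≤ C := fun x => (abs_of_nonneg (h0 x)).trans_le (hC x)
  have hab2 : ∀ x, |F x ^ 2| ≤ C ^ 2 := fun x => by
    rw [abs_pow]; exact pow_le_pow_left₀ (abs_nonneg _) (hab x) 2
  have hF2 : Measurable fun x => F x ^ 2 := hF.pow_const 2
  set G : α → ℝ := fun u => (∫ v, F v ^ 2 ∂(κ u)) - F u ^ 2 with hG
  have hGi : Integrable G ρ :=
    (Integrable.of_abs_le (κ.measurable_integral_of_measurable hF2)
      fun u => abs_integral_le_of_abs_le hab2).sub (.of_abs_le hF2 hab2)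
  have hG0 : ∫ u, G u ∂ρ = 0 := by
    rw [hG, integral_sub (Integrable.of_abs_le (κ.measurable_integral_of_measurable hF2)
      fun u => abs_integral_le_of_abs_le hab2) (.of_abs_le hF2 hab2),
      ← κ.integral_bind_of_abs_le ρ hF2 hab2, hρ.def, sub_self]
  have hsq : ∀ u, ∫ v, (F v - F u) ^ 2 ∂(κ u) ≤ G u := by
    intro u
    have h1 : ∫ v, (F v - F u) ^ 2 ∂(κ u)
        = (∫ v, F v ^ 2 ∂(κ u)) - 2 * F u * (∫ v, F v ∂(κ u)) + F u ^ 2 := by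
      have : ∀ v, (F v - F u) ^ 2 = F v ^ 2 - 2 * F u * F v + F u ^ 2 := fun v => by ring
      simp_rw [this]
      have i1 : Integrable (fun v => F v ^ 2) (κ u) := .of_abs_le hF2 hab2
      have i2 : Integrable (fun v => 2 * F u * F v) (κ u) :=
        (Integrable.of_abs_le hF hab).const_mul _
      have i3 : Integrable (fun v => F v ^ 2 - 2 * F u * F v) (κ u) := i1.sub i2
      rw [integral_add i3 (integrable_const _), integral_sub i1 i2, integral_const_mul]
      simp
    rw [h1, hG]
    nlinarith [mul_le_mul_of_nonneg_left (hsub u) (h0 u)]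
  have hnn : ∀ u, 0 ≤ ∫ v, (F v - F u) ^ 2 ∂(κ u) := fun u => integral_nonneg fun v => sq_nonneg _
  have hae : G =ᵐ[ρ] 0 :=
    (integral_eq_zero_iff_of_nonneg (fun u => (hnn u).trans (hsq u)) hGi).1 hG0
  filter_upwards [hae] with u hu
  have hz : ∫ v, (F v - F u) ^ 2 ∂(κ u) = 0 :=
    le_antisymm ((hsq u).trans_eq hu) (hnn u)
  have hi : Integrable (fun v => (F v - F u) ^ 2) (κ u) := by
    refine .of_abs_le (C := (2 * C) ^ 2) ((hF.sub_const _).pow_const 2) fun v => ?_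
    rw [abs_pow]
    exact pow_le_pow_left₀ (abs_nonneg _)
      ((abs_sub _ _).trans (by linarith [hab v, hab u])) 2
  filter_upwards [(integral_eq_zero_iff_of_nonneg (fun v => sq_nonneg _) hi).1 hz] with v hv
  have : F v - F u = 0 := by simpa using hv
  linarith

theorem ProbabilityTheory.Kernel.Invariant.parallelComp {κ : Kernel α α} {η : Kernel β β}
    [IsMarkovKernel κ] [IsMarkovKernel η] {μ : Measure α} {ν : Measure β}
    [IsProbabilityMeasure μ] [IsProbabilityMeasure ν] (hμ : κ.Invariant μ) (hν : η.Invariant ν) :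
    (κ ∥ₖ η).Invariant (μ.prod ν) := by
  refine (Measure.prod_eq fun s t hs ht => ?_).symm
  rw [Measure.bind_apply (hs.prod ht) (Kernel.aemeasurable _)]
  simp_rw [Kernel.parallelComp_apply_prod]
  rw [MeasureTheory.lintegral_prod_mul (κ.measurable_coe hs).aemeasurable
      (η.measurable_coe ht).aemeasurable,
    ← Measure.bind_apply hs (Kernel.aemeasurable _), ← Measure.bind_apply ht (Kernel.aemeasurable _),
    hμ.def, hν.def]

/-- A dominated form of the reverse Fatou lemma for signed functions, along any countably generated
filter; the upper bound `b` is given, so that no measurability of an upper limit is needed. -/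
theorem MeasureTheory.eventually_abs_integral_le {ι : Type*} {l : Filter ι}
    [l.IsCountablyGenerated] {ρ : Measure α} [IsProbabilityMeasure ρ] {h : ι → α → ℝ}
    (hm : ∀ i, Measurable (h i)) {C : ℝ} (hC : ∀ i x, |h i x| ≤ C) {b : α → ℝ}
    (hb : Measurable b) (hb0 : ∀ x, 0 ≤ b x) {B : ℝ} (hB : ∀ x, b x ≤ B)
    (hlim : ∀ᵐ x ∂ρ, ∀ ε > 0, ∀ᶠ i in l, |h i x| ≤ b x + ε) {ε : ℝ} (hε : 0 < ε) :
    ∀ᶠ i in l, |∫ x, h i x ∂ρ| ≤ ∫ x, b x ∂ρ + ε := by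
  set g : ι → α → ℝ := fun i x => max (|h i x| - b x) 0 with hg
  have hgm : ∀ i, Measurable (g i) := fun i => (((hm i).abs).sub hb).max measurable_const
  have hgC : ∀ i x, |g i x| ≤ C := fun i x => by
    rw [abs_of_nonneg (le_max_right _ _)]
    exact max_le (by linarith [hC i x, hb0 x]) ((abs_nonneg _).trans (hC i x))
  have hbi : Integrable b ρ :=
    .of_abs_le hb (C := B) fun x => (abs_of_nonneg (hb0 x)).trans_le (hB x)
  have ht : Tendsto (fun i => ∫ x, g i x ∂ρ) l (𝓝 (∫ _, (0 : ℝ) ∂ρ)) := by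
    refine tendsto_integral_filter_of_dominated_convergence (fun _ => C)
      (Eventually.of_forall fun i => (hgm i).aestronglyMeasurable)
      (Eventually.of_forall fun i => Eventually.of_forall fun x => hgC i x)
      (integrable_const _) ?_
    filter_upwards [hlim] with x hx
    refine Metric.tendsto_nhds.2 fun δ hδ => ?_
    filter_upwards [hx (δ / 2) (by linarith)] with i hi
    rw [Real.dist_eq, sub_zero, abs_of_nonneg (le_max_right _ _)]
    exact max_lt (by linarith) hδ
  rw [integral_zero] at ht
  filter_upwards [ht.eventually_lt_const hε] with i hi
  have hgi : Integrable (g i) ρ := .of_abs_le (hgm i) (hgC i)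
  calc |∫ x, h i x ∂ρ| ≤ ∫ x, |h i x| ∂ρ := abs_integral_le_integral_abs
    _ ≤ ∫ x, (b x + g i x) ∂ρ := by
      refine integral_mono (Integrable.of_abs_le (hm i) (hC i)).abs (hbi.add hgi) fun x => ?_
      have := le_max_left (|h i x| - b x) 0
      simp only [hg]; linarith
    _ = ∫ x, b x ∂ρ + ∫ x, g i x ∂ρ := integral_add hbi hgi
    _ ≤ _ := by linarith

theorem MeasureTheory.integral_sub_integral_eq_integral_prod {μ : Measure α} {ν : Measure β}
    [IsProbabilityMeasure μ] [IsProbabilityMeasure ν] {f : α → ℝ} {g : β → ℝ}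
    (hf : Integrable f μ) (hg : Integrable g ν) :
    ∫ x, f x ∂μ - ∫ y, g y ∂ν = ∫ p, (f p.1 - g p.2) ∂(μ.prod ν) := by
  rw [integral_sub (hf.comp_fst ν) (hg.comp_snd μ), integral_fun_fst, integral_fun_snd]
  simp

end KernelLemmas

theorem eventually_atTop_of_add_left {p : ℝ≥0 → Prop} (s : ℝ≥0)
    (h : ∀ᶠ t in atTop, p (s + t)) : ∀ᶠ t in atTop, p t := by
  obtain ⟨T, hT⟩ := eventually_atTop.1 h
  refine eventually_atTop.2 ⟨s + T, fun t ht => ?_⟩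
  have hs : s ≤ t := le_self_add.trans ht
  rw [← add_tsub_cancel_of_le hs]
  exact hT _ (le_tsub_of_add_le_left ht)

namespace MarkovFellerSemigroup

/-! ### The semigroup on bounded measurable functions -/

section Basic

variable {E : Type*} [TopologicalSpace E] [MeasurableSpace E] (P : MarkovFellerSemigroup E)

theorem measurable_apply (t : ℝ≥0) {f : E → ℝ} (hf : Measurable f) : Measurable (P.apply t f) :=
  (P.kernel t).measurable_integral_of_measurable hf

theorem abs_apply_le (t : ℝ≥0) {f : E → ℝ} {C : ℝ} (hC : ∀ x, |f x| ≤ C) (x : E) :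
    |P.apply t f x| ≤ C :=
  abs_integral_le_of_abs_le hC

theorem apply_add (s t : ℝ≥0) {f : E → ℝ} (hf : Measurable f) {C : ℝ} (hC : ∀ x, |f x| ≤ C)
    (x : E) : P.apply (s + t) f x = ∫ y, P.apply t f y ∂(P.kernel s x) := by
  rw [apply, P.kernel_add, Kernel.comp_apply, Kernel.integral_bind_of_abs_le _ _ hf hC]
  rfl

theorem integral_dual (t : ℝ≥0) (ν : ProbabilityMeasure E) {f : E → ℝ} (hf : Measurable f) {C : ℝ}
    (hC : ∀ x, |f x| ≤ C) : ∫ y, f y ∂(P.dual t ν : Measure E) = ∫ x, P.apply t f x ∂ν :=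
  Kernel.integral_bind_of_abs_le _ _ hf hC

theorem IsInvariant.kernel_invariant {P : MarkovFellerSemigroup E} {μ : ProbabilityMeasure E}
    (hμ : P.IsInvariant μ) (t : ℝ≥0) : (P.kernel t).Invariant (μ : Measure E) :=
  congrArg (fun ν : ProbabilityMeasure E => (ν : Measure E)) (hμ t)

theorem IsInvariant.integral_apply {P : MarkovFellerSemigroup E} {μ : ProbabilityMeasure E}
    (hμ : P.IsInvariant μ) (t : ℝ≥0) {f : E → ℝ} (hf : Measurable f) {C : ℝ}
    (hC : ∀ x, |f x| ≤ C) : ∫ x, P.apply t f x ∂(μ : Measure E) = ∫ x, f x ∂(μ : Measure E) := by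
  rw [← P.integral_dual t μ hf hC, hμ t]

theorem measurable_apply_sub_apply (t : ℝ≥0) {f : E → ℝ} (hf : Measurable f) :
    Measurable fun p : E × E => P.apply t f p.1 - P.apply t f p.2 :=
  ((P.measurable_apply t hf).comp measurable_fst).sub
    ((P.measurable_apply t hf).comp measurable_snd)

theorem abs_apply_sub_apply_le (t : ℝ≥0) {f : E → ℝ} {C : ℝ} (hC : ∀ x, |f x| ≤ C) (x y : E) :
    |P.apply t f x - P.apply t f y| ≤ 2 * C :=
  (abs_sub _ _).trans (by linarith [P.abs_apply_le t hC x, P.abs_apply_le t hC y])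

theorem integral_apply_sub_integral_apply (t : ℝ≥0) {f : E → ℝ} (hf : Measurable f) {C : ℝ}
    (hC : ∀ x, |f x| ≤ C) (μ ν : Measure E) [IsProbabilityMeasure μ] [IsProbabilityMeasure ν] :
    ∫ x, P.apply t f x ∂μ - ∫ y, P.apply t f y ∂ν
      = ∫ p, (P.apply t f p.1 - P.apply t f p.2) ∂(μ.prod ν) :=
  integral_sub_integral_eq_integral_prod
    (.of_abs_le (P.measurable_apply t hf) (P.abs_apply_le t hC))
    (.of_abs_le (P.measurable_apply t hf) (P.abs_apply_le t hC))

/-- The increments of `P_{s+t} f` are those of `P_t f` averaged over the independent coupling of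
`P_s(x, ·)` and `P_s(y, ·)`. -/
theorem apply_add_sub_apply_add (s t : ℝ≥0) {f : E → ℝ} (hf : Measurable f) {C : ℝ}
    (hC : ∀ x, |f x| ≤ C) (x y : E) :
    P.apply (s + t) f x - P.apply (s + t) f y
      = ∫ p, (P.apply t f p.1 - P.apply t f p.2) ∂((P.kernel s x).prod (P.kernel s y)) := by
  rw [P.apply_add s t hf hC, P.apply_add s t hf hC, P.integral_apply_sub_integral_apply t hf hC]

theorem apply_indicator_one (t : ℝ≥0) {A : Set E} (hA : MeasurableSet A) (x : E) :
    P.apply t (A.indicator 1) x = (P.kernel t x).real A :=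
  integral_indicator_one hA

/-- If `P_t(y, A)` is eventually at least `a` for each `y ∈ D`, then `P_t(x, A)` is eventually at
least `a' * q` for each `a' < a` and each `x` from which `D` has probability at least `q` at some
time. -/
theorem eventually_mul_le_kernel_real {A D : Set E} (hA : MeasurableSet A) (hD : MeasurableSet D)
    {a a' q : ℝ} (ha0 : 0 ≤ a') (ha : a' < a) (hq : 0 < q)
    (hDA : ∀ y ∈ D, ∀ᶠ t in atTop, a ≤ (P.kernel t y).real A) {s : ℝ≥0} {x : E}
    (hs : q ≤ (P.kernel s x).real D) : ∀ᶠ t in atTop, a' * q ≤ (P.kernel t x).real A := by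
  refine eventually_atTop_of_add_left s ?_
  have hfm : Measurable ((Aᶜ : Set E).indicator (1 : E → ℝ)) :=
    measurable_const.indicator hA.compl
  have hfC : ∀ y, |(Aᶜ : Set E).indicator (1 : E → ℝ) y| ≤ 1 := fun y => by
    by_cases hy : y ∈ Aᶜ <;> simp [hy]
  have hcompl : ∀ t y, P.apply t ((Aᶜ : Set E).indicator 1) y = 1 - (P.kernel t y).real A :=
    fun t y => by rw [P.apply_indicator_one t hA.compl, probReal_compl_eq_one_sub hA]
  by_cases ha1 : a ≤ 1
  · have hb : ∀ y, (1 : ℝ) - D.indicator (fun _ => a) y ≤ 1 ∧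
        0 ≤ (1 : ℝ) - D.indicator (fun _ => a) y := fun y => by
      by_cases hy : y ∈ D <;> simp [hy]
      exact ⟨by linarith, ha1⟩
    have key := eventually_abs_integral_le (ρ := P.kernel s x) (l := atTop)
      (h := fun t y => P.apply t ((Aᶜ : Set E).indicator 1) y) (C := 1)
      (b := fun y => 1 - D.indicator (fun _ => a) y) (B := 1)
      (fun t => P.measurable_apply t hfm) (fun t y => P.abs_apply_le t hfC y)
      (measurable_const.sub (measurable_const.indicator hD)) (fun y => (hb y).2) (fun y => (hb y).1)
      (ε := (a - a') * q) ?_ (mul_pos (by linarith) hq)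
    · filter_upwards [key] with t ht
      have hI : ∫ y, (1 - D.indicator (fun _ => a) y) ∂(P.kernel s x)
          = 1 - (P.kernel s x).real D * a := by
        rw [integral_sub (integrable_const _) ((integrable_const a).indicator hD),
          integral_indicator_const a hD]
        simp
      rw [hI, ← P.apply_add s t hfm hfC, hcompl] at ht
      have h1 := (abs_le.1 ht).2
      have h2 : q * a ≤ (P.kernel s x).real D * a :=
        mul_le_mul_of_nonneg_right hs (ha0.trans ha.le)
      nlinarith
    · refine Eventually.of_forall fun y ε hε => ?_
      by_cases hy : y ∈ D
      · filter_upwards [hDA y hy] with t ht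
        rw [hcompl, Set.indicator_of_mem hy,
          abs_of_nonneg (by linarith [measureReal_le_one (μ := P.kernel t y) (s := A)])]
        linarith
      · refine Eventually.of_forall fun t => ?_
        rw [Set.indicator_of_notMem hy]
        linarith [P.abs_apply_le t hfC y]
  · -- For `a > 1` the hypothesis on `D` can only hold vacuously.
    have : D = ∅ := Set.eq_empty_of_forall_notMem fun y hy => by
      obtain ⟨t, ht⟩ := (hDA y hy).exists
      exact ha1 (ht.trans measureReal_le_one)
    simp [this] at hs
    linarith

end Basic

/-! ### Consequences of eventual continuity at a point -/

section Metric

variable {E : Type*} [MetricSpace E] [MeasurableSpace E]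
  {P : MarkovFellerSemigroup E} {z : E}

theorem EventuallyContinuousAt.exists_ball (h : P.EventuallyContinuousAt z) {f : E → ℝ} {K : ℝ≥0}
    (hf : LipschitzWith K f) {C : ℝ} (hC : ∀ x, |f x| ≤ C) {η : ℝ} (hη : 0 < η) :
    ∃ δ > 0, ∀ x ∈ Metric.ball z δ, ∀ᶠ t in atTop, |P.apply t f x - P.apply t f z| < η := by
  have h0 := h f ⟨K, hf⟩ ⟨C, hC⟩
  have h1 := eventually_lt_of_limsup_lt (h0.trans_lt (ENNReal.ofReal_pos.2 hη))
  obtain ⟨δ, hδ, hball⟩ := Metric.eventually_nhds_iff_ball.1 h1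
  refine ⟨δ, hδ, fun x hx => ?_⟩
  filter_upwards [eventually_lt_of_limsup_lt (hball x hx)] with t ht
  exact (ENNReal.ofReal_lt_ofReal_iff hη).1 ht

theorem EventuallyContinuousAt.exists_ball_sub_le (h : P.EventuallyContinuousAt z) {f : E → ℝ}
    {K : ℝ≥0} (hf : LipschitzWith K f) {C : ℝ} (hC : ∀ x, |f x| ≤ C) {η : ℝ} (hη : 0 < η) :
    ∃ δ > 0, ∀ x ∈ Metric.ball z δ, ∀ y ∈ Metric.ball z δ,
      ∀ᶠ t in atTop, |P.apply t f x - P.apply t f y| ≤ η := by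
  obtain ⟨δ, hδ, hball⟩ := h.exists_ball hf hC (half_pos hη)
  refine ⟨δ, hδ, fun x hx y hy => ?_⟩
  filter_upwards [hball x hx, hball y hy] with t h1 h2
  rw [abs_sub_comm] at h2
  calc |P.apply t f x - P.apply t f y|
      ≤ |P.apply t f x - P.apply t f z| + |P.apply t f z - P.apply t f y| := abs_sub_le _ _ _
    _ ≤ η := by linarith

variable [BorelSpace E]

/-- Eventual continuity at `z` spreads the recurrence of `z` to a neighbourhood of `z`. -/
theorem EventuallyContinuousAt.exists_ball_le_kernel_real (h : P.EventuallyContinuousAt z)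
    (hz : ∀ ε : ℝ, 0 < ε → 0 < liminf (fun t : ℝ≥0 => P.kernel t z (Metric.ball z ε)) atTop)
    {ε : ℝ} (hε : 0 < ε) :
    ∃ δ > 0, ∃ a > 0, ∀ y ∈ Metric.ball z δ, ∀ᶠ t in atTop,
      a ≤ (P.kernel t y).real (Metric.ball z ε) := by
  -- The test function lies between `ε / 2` times the indicator of the ball of radius `ε / 2` and
  -- `ε` times that of the ball of radius `ε`.
  set f : E → ℝ := fun y => max 0 (ε - dist y z) with hf
  have hfL : LipschitzWith 1 f := by
    have : LipschitzWith 1 fun y : E => ε - dist y z := by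
      simpa using (LipschitzWith.const (α := E) ε).sub (LipschitzWith.dist_left z)
    exact this.const_max 0
  have hf0 : ∀ y, 0 ≤ f y := fun y => le_max_left _ _
  have hfε : ∀ y, |f y| ≤ ε := fun y => by
    rw [abs_of_nonneg (hf0 y)]
    exact max_le hε.le (by linarith [dist_nonneg (x := y) (y := z)])
  have hfm : Measurable f := hfL.continuous.measurable
  have hup : ∀ t y, P.apply t f y ≤ (P.kernel t y).real (Metric.ball z ε) * ε := fun t y => by
    rw [← smul_eq_mul, ← integral_indicator_const ε Metric.isOpen_ball.measurableSet]
    refine integral_mono (.of_abs_le hfm hfε)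
      ((integrable_const ε).indicator Metric.isOpen_ball.measurableSet) fun w => ?_
    by_cases hw : w ∈ Metric.ball z ε
    · rw [Set.indicator_of_mem hw]; exact (le_abs_self _).trans (hfε w)
    · rw [Set.indicator_of_notMem hw]
      rw [Metric.mem_ball, not_lt] at hw
      exact max_le le_rfl (by linarith)
  have hlow : ∀ t y, (P.kernel t y).real (Metric.ball z (ε / 2)) * (ε / 2) ≤ P.apply t f y :=
    fun t y => by
    rw [← smul_eq_mul, ← integral_indicator_const (ε / 2) Metric.isOpen_ball.measurableSet]
    refine integral_mono ((integrable_const (ε / 2)).indicator Metric.isOpen_ball.measurableSet)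
      (.of_abs_le hfm hfε) fun w => ?_
    by_cases hw : w ∈ Metric.ball z (ε / 2)
    · rw [Set.indicator_of_mem hw]
      rw [Metric.mem_ball] at hw
      exact (by linarith : ε / 2 ≤ ε - dist w z).trans (le_max_right _ _)
    · rw [Set.indicator_of_notMem hw]; exact hf0 w
  obtain ⟨c, hc0, hc⟩ := ENNReal.lt_iff_exists_nnreal_btwn.1 (hz (ε / 2) (half_pos hε))
  have hc0' : (0 : ℝ) < c := by exact_mod_cast hc0
  have hzc : ∀ᶠ t in atTop, (c : ℝ) ≤ (P.kernel t z).real (Metric.ball z (ε / 2)) := by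
    filter_upwards [eventually_lt_of_lt_liminf hc] with t ht
    have := ENNReal.toReal_mono (measure_ne_top _ _) ht.le
    simpa [measureReal_def] using this
  obtain ⟨δ, hδ, hball⟩ := h.exists_ball hfL hfε (η := c * ε / 4) (by positivity)
  refine ⟨δ, hδ, c / 4, by positivity, fun y hy => ?_⟩
  filter_upwards [hball y hy, hzc] with t h1 h2
  have h3 := hup t y
  have h4 := hlow t z
  have h5 := (abs_lt.1 h1).1
  have h6 := mul_le_mul_of_nonneg_right h2 (half_pos hε).le
  refine le_of_mul_le_mul_right (?_ : c / 4 * ε ≤ _) hε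
  linarith

end Metric

end MarkovFellerSemigroup

theorem MeasureTheory.ProbabilityMeasure.eq_of_forall_lipschitz_integral_eq {Ω : Type*}
    [MetricSpace Ω] [MeasurableSpace Ω] [BorelSpace Ω] {μ ν : ProbabilityMeasure Ω}
    (h : ∀ f : Ω → ℝ, ∀ C : ℝ, (∀ x, |f x| ≤ C) → ∀ K, LipschitzWith K f →
      ∫ x, f x ∂(μ : Measure Ω) = ∫ x, f x ∂(ν : Measure Ω)) : μ = ν := by
  have ht : Tendsto (fun _ : ℕ => μ) atTop (𝓝 ν) := by
    rw [tendsto_iff_forall_lipschitz_integral_tendsto]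
    rintro f ⟨C, hC⟩ ⟨K, hK⟩
    rcases isEmpty_or_nonempty Ω with hΩ | ⟨⟨x₀⟩⟩
    · simp [Measure.eq_zero_of_isEmpty]
    rw [h f (C + |f x₀|) (fun x => ?_) K hK]
    · exact tendsto_const_nhds
    · have := hC x x₀
      rw [Real.dist_eq] at this
      linarith [abs_sub_abs_le_abs_sub (f x) (f x₀)]
  exact tendsto_nhds_unique tendsto_const_nhds ht

namespace MarkovFellerSemigroup

/-! ### Uniqueness of the invariant measure -/

section Uniqueness

variable {E : Type*} [MetricSpace E] [MeasurableSpace E] [BorelSpace E]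
  {P : MarkovFellerSemigroup E} {z : E}

/-- The asymptotic oscillation `F(x, y) = limsup_n |P_n f(x) - P_n f(y)|` is subharmonic for every
kernel `P_k ⊗ P_k` of two independent copies of the process, so under the product of two invariant
measures it is constant along the transitions of the pair. The pair reaches every neighbourhood of
`(z, z)`, where `F` is small, so `F` vanishes almost everywhere. -/
theorem ae_prod_eventually_abs_apply_sub_apply_le
    (hz : P.EventuallyContinuousAt z)
    (hrec : ∀ x, ∀ ε > 0, ∃ m > 0, ∀ᶠ t in atTop, m ≤ (P.kernel t x).real (Metric.ball z ε))
    {μ ν : ProbabilityMeasure E} (hμ : P.IsInvariant μ) (hν : P.IsInvariant ν) {f : E → ℝ} {C : ℝ}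
    (hC : ∀ x, |f x| ≤ C) {K : ℝ≥0} (hK : LipschitzWith K f) :
    ∀ᵐ p ∂((μ : Measure E).prod (ν : Measure E)), ∀ ε > 0, ∀ᶠ n : ℕ in atTop,
      |P.apply n f p.1 - P.apply n f p.2| ≤ ε := by
  have hf : Measurable f := hK.continuous.measurable
  set D : ℕ → E × E → ℝ := fun n p => |P.apply n f p.1 - P.apply n f p.2| with hD
  set F : E × E → ℝ := fun p => limsup (fun n => D n p) atTop with hF
  have hDC : ∀ n p, D n p ≤ 2 * C := fun n p => P.abs_apply_sub_apply_le n hC p.1 p.2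
  have hD0 : ∀ n p, 0 ≤ D n p := fun n p => abs_nonneg _
  have hbdd : ∀ p, IsBoundedUnder (· ≤ ·) atTop fun n => D n p := fun p =>
    isBoundedUnder_of ⟨2 * C, fun n => hDC n p⟩
  have hcobdd : ∀ p, IsCoboundedUnder (· ≤ ·) atTop fun n => D n p := fun p =>
    (isBoundedUnder_of ⟨0, fun n => hD0 n p⟩ : IsBoundedUnder (· ≥ ·) atTop _).isCoboundedUnder_le
  have hDm : ∀ n, Measurable (D n) := fun n => (P.measurable_apply_sub_apply n hf).abs
  have hFm : Measurable F := Measurable.limsup hDm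
  have hF_le : ∀ p a, (∀ᶠ n in atTop, D n p ≤ a) → F p ≤ a := fun p a h =>
    limsup_le_of_le (hcobdd p) h
  have hFC : ∀ p, F p ≤ 2 * C := fun p => hF_le p _ (Eventually.of_forall fun n => hDC n p)
  have hF0 : ∀ p, 0 ≤ F p := fun p =>
    le_limsup_of_frequently_le (Eventually.of_forall fun n => hD0 n p).frequently (hbdd p)
  have hFev : ∀ p, ∀ ε > 0, ∀ᶠ n in atTop, D n p ≤ F p + ε := fun p ε hε =>
    (eventually_lt_of_limsup_lt (lt_add_of_pos_right (F p) hε) (hbdd p)).mono fun _ h => h.le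
  have hsub : ∀ k : ℕ, ∀ p, F p ≤ ∫ q, F q ∂((P.kernel k ∥ₖ P.kernel k) p) := fun k p => by
    rw [Kernel.parallelComp_apply]
    refine le_of_forall_pos_le_add fun ε hε => hF_le p _ ?_
    have key := eventually_abs_integral_le (ρ := (P.kernel k p.1).prod (P.kernel k p.2))
      (h := fun (n : ℕ) (q : E × E) => P.apply n f q.1 - P.apply n f q.2) (l := atTop)
      (fun n => P.measurable_apply_sub_apply n hf)
      (fun n q => P.abs_apply_sub_apply_le n hC q.1 q.2) hFm hF0 hFC
      (Eventually.of_forall hFev) hε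
    obtain ⟨N, hN⟩ := eventually_atTop.1 key
    refine eventually_atTop.2 ⟨k + N, fun n hn => ?_⟩
    obtain ⟨j, rfl⟩ := Nat.exists_eq_add_of_le ((Nat.le_add_right k N).trans hn)
    have := hN j (by omega)
    rw [← P.apply_add_sub_apply_add k j hf hC] at this
    simpa [hD] using this
  have hconst : ∀ᵐ p ∂((μ : Measure E).prod (ν : Measure E)), ∀ k : ℕ,
      ∀ᵐ q ∂((P.kernel k ∥ₖ P.kernel k) p), F q = F p :=
    ae_all_iff.2 fun k => Kernel.Invariant.ae_ae_eq_of_subharmonic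
      ((hμ.kernel_invariant k).parallelComp (hν.kernel_invariant k)) hFm hF0 hFC (hsub k)
  filter_upwards [hconst] with p hp ε hε
  obtain ⟨δ, hδ, hball⟩ := hz.exists_ball_sub_le hK hC (half_pos hε)
  set B := Metric.ball z δ
  obtain ⟨m₁, hm₁, h₁⟩ := hrec p.1 δ hδ
  obtain ⟨m₂, hm₂, h₂⟩ := hrec p.2 δ hδ
  obtain ⟨k, hk₁, hk₂⟩ :=
    (((tendsto_natCast_atTop_atTop (R := ℝ≥0)).eventually h₁).and
      ((tendsto_natCast_atTop_atTop (R := ℝ≥0)).eventually h₂)).exists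
  have hpos : (P.kernel k ∥ₖ P.kernel k) p (B ×ˢ B) ≠ 0 := by
    have h1 : P.kernel k p.1 B ≠ 0 := (measureReal_ne_zero_iff).1 (hm₁.trans_le hk₁).ne'
    have h2 : P.kernel k p.2 B ≠ 0 := (measureReal_ne_zero_iff).1 (hm₂.trans_le hk₂).ne'
    rw [Kernel.parallelComp_apply_prod]
    exact mul_ne_zero h1 h2
  obtain ⟨q, hqB, hq⟩ :=
    ((frequently_ae_mem_iff.2 hpos).and_eventually (hp k)).exists
  have hFq : F q ≤ ε / 2 := hF_le q _
    (tendsto_natCast_atTop_atTop.eventually (hball q.1 hqB.1 q.2 hqB.2))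
  filter_upwards [hFev p (ε / 2) (half_pos hε)] with n hn
  exact hn.trans (by linarith)

theorem IsInvariant.eq_of_eventuallyContinuousAt
    (hz : P.EventuallyContinuousAt z)
    (hrec : ∀ x, ∀ ε > 0, ∃ m > 0, ∀ᶠ t in atTop, m ≤ (P.kernel t x).real (Metric.ball z ε))
    {μ ν : ProbabilityMeasure E} (hμ : P.IsInvariant μ) (hν : P.IsInvariant ν) : μ = ν := by
  refine ProbabilityMeasure.eq_of_forall_lipschitz_integral_eq fun f C hC K hK => ?_
  have hf : Measurable f := hK.continuous.measurable
  refine sub_eq_zero.1 (abs_nonpos_iff.1 (le_of_forall_pos_le_add fun ε hε => ?_))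
  have key := eventually_abs_integral_le (ρ := (μ : Measure E).prod (ν : Measure E))
    (h := fun (n : ℕ) (q : E × E) => P.apply n f q.1 - P.apply n f q.2) (l := atTop)
    (b := fun _ => 0) (B := 0) (fun n => P.measurable_apply_sub_apply n hf)
    (fun n q => P.abs_apply_sub_apply_le n hC q.1 q.2) measurable_const (fun _ => le_rfl)
    (fun _ => le_rfl)
    (by simpa using ae_prod_eventually_abs_apply_sub_apply_le hz hrec hμ hν hC hK) hε
  obtain ⟨n, hn⟩ := key.exists
  rwa [← P.integral_apply_sub_integral_apply n hf hC, hμ.integral_apply n hf hC,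
    hν.integral_apply n hf hC, integral_zero] at hn

end Uniqueness

/-! ### Time averages and existence of an invariant measure -/

section KrylovBogoliubov

section Cesaro

variable {E : Type*} [TopologicalSpace E] [MeasurableSpace E] (P : MarkovFellerSemigroup E)

/-- The transition probabilities out of a fixed point `x`, as a kernel in the time variable. -/
noncomputable def timeKernel (x : E) : Kernel ℝ E :=
  ⟨fun s : ℝ => P.kernel s.toNNReal x, P.measurable_kernel_toNNReal x⟩

instance isMarkovKernel_timeKernel (x : E) : IsMarkovKernel (P.timeKernel x) :=
  ⟨fun s => inferInstanceAs (IsProbabilityMeasure (P.kernel s.toNNReal x))⟩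

theorem measurable_apply_toNNReal {f : E → ℝ} (hf : Measurable f) (x : E) :
    Measurable fun r : ℝ => P.apply r.toNNReal f x :=
  (P.timeKernel x).measurable_integral_of_measurable hf

theorem integral_cesaro (t : ℝ≥0) (x : E) {f : E → ℝ} (hf : Measurable f) {C : ℝ}
    (hC : ∀ x, |f x| ≤ C) :
    ∫ y, f y ∂(P.cesaro t x) = (t : ℝ)⁻¹ * ∫ r in (0 : ℝ)..t, P.apply r.toNNReal f x := by
  rw [cesaro, integral_smul_measure, intervalIntegral.integral_of_le (NNReal.coe_nonneg t)]
  have := (P.timeKernel x).integral_bind_of_abs_le (volume.restrict (Set.Ioc (0 : ℝ) t)) hf hC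
  simp only [ENNReal.toReal_inv, ENNReal.coe_toReal, smul_eq_mul]
  exact congrArg _ this

/-- Shifting the time average by `s` moves it by `O(s / t)`. -/
theorem abs_integral_apply_cesaro_sub_le (s t : ℝ≥0) (x : E) {f : E → ℝ} (hf : Measurable f)
    {C : ℝ} (hC : ∀ x, |f x| ≤ C) :
    |∫ y, P.apply s f y ∂(P.cesaro t x) - ∫ y, f y ∂(P.cesaro t x)| ≤ (t : ℝ)⁻¹ * (2 * C * s) := by
  set g : ℝ → ℝ := fun r => P.apply r.toNNReal f x with hg
  have hgm : Measurable g := P.measurable_apply_toNNReal hf x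
  have hgC : ∀ r, |g r| ≤ C := fun r => P.abs_apply_le _ hC x
  have hgi : ∀ a b, IntervalIntegrable g volume a b := fun a b =>
    ⟨.of_abs_le hgm hgC, .of_abs_le hgm hgC⟩
  have hshift : ∫ r in (0 : ℝ)..t, P.apply r.toNNReal (P.apply s f) x
      = ∫ r in (0 : ℝ)..t, g (r + s) := by
    refine intervalIntegral.integral_congr fun r hr => ?_
    rw [Set.uIcc_of_le (NNReal.coe_nonneg t)] at hr
    simp only [hg, Real.toNNReal_add hr.1 (NNReal.coe_nonneg s), Real.toNNReal_coe]
    rw [P.apply_add _ _ hf hC]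
    rfl
  have hb : ∀ a b : ℝ, |∫ r in a..b, g r| ≤ C * |b - a| := fun a b =>
    intervalIntegral.norm_integral_le_of_norm_le_const (f := g) fun r _ => hgC r
  rw [P.integral_cesaro t x (P.measurable_apply s hf) (P.abs_apply_le s hC),
    P.integral_cesaro t x hf hC, ← mul_sub, hshift, intervalIntegral.integral_comp_add_right,
    zero_add, intervalIntegral.integral_interval_sub_interval_comm (hgi _ _) (hgi _ _) (hgi _ _),
    abs_mul, abs_of_nonneg (inv_nonneg.2 (NNReal.coe_nonneg t))]
  refine mul_le_mul_of_nonneg_left ?_ (inv_nonneg.2 (NNReal.coe_nonneg t))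
  have h1 := hb s 0
  have h2 := hb (t + s) t
  have hs : |(0 : ℝ) - s| = s := by simp
  have ht : |(t : ℝ) - (t + s)| = s := by simp
  rw [hs] at h1
  rw [ht] at h2
  have := abs_sub (∫ r in (s : ℝ)..0, g r) (∫ r in (t + s : ℝ)..t, g r)
  linarith

theorem exists_lt_kernel_of_lt_cesaro {t : ℝ≥0} (ht : 0 < t) {x : E} {A : Set E}
    (hA : MeasurableSet A) {c : ℝ≥0∞} (hc : c < P.cesaro t x A) :
    ∃ s, c < P.kernel s x A := by
  by_contra! hcon
  refine hc.not_ge ?_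
  rw [P.cesaro_apply t x hA]
  calc (t : ℝ≥0∞)⁻¹ * ∫⁻ s in Set.Ioc (0 : ℝ) t, P.kernel s.toNNReal x A
      ≤ (t : ℝ≥0∞)⁻¹ * ∫⁻ _ in Set.Ioc (0 : ℝ) t, c := by
        gcongr; exact hcon _
    _ = c := by
        simp only [lintegral_const, Measure.restrict_apply MeasurableSet.univ, Set.univ_inter,
          Real.volume_Ioc, sub_zero, ENNReal.ofReal_coe_nnreal]
        rw [mul_comm c, ← mul_assoc, ENNReal.inv_mul_cancel (by simpa using ht.ne') (by simp),
          one_mul]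

end Cesaro

variable {E : Type*} [MetricSpace E] [PolishSpace E] [MeasurableSpace E] [BorelSpace E]
  (P : MarkovFellerSemigroup E)

/-- The time average `Q_{n+1}(x, ·)` as a probability measure; the shift by one avoids `t = 0`. -/
noncomputable def cesaroProb (x : E) (n : ℕ) : ProbabilityMeasure E :=
  ⟨P.cesaro (n + 1) x, P.isProbabilityMeasure_cesaro (by positivity) x⟩

/-- **Krylov-Bogoliubov**: if the time averages started at `x` are tight, they have a weak limit
point, and it is an invariant measure. -/
theorem exists_isInvariant_tendsto_cesaroProb {x : E} (hx : x ∈ P.tightPoints) :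
    ∃ μ : ProbabilityMeasure E, P.IsInvariant μ ∧ ∃ φ : ℕ → ℕ, StrictMono φ ∧
      Tendsto (fun n => P.cesaroProb x (φ n)) atTop (𝓝 μ) := by
  have hcomp : IsCompact (closure (Set.range (P.cesaroProb x))) := by
    refine isCompact_closure_of_isTightMeasureSet (IsTightMeasureSet.subset hx ?_)
    rintro _ ⟨_, ⟨n, rfl⟩, rfl⟩
    exact ⟨n + 1, by positivity, rfl⟩
  obtain ⟨μ, -, φ, hφ, hlim⟩ :=
    hcomp.tendsto_subseq fun n => subset_closure (Set.mem_range_self n)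
  refine ⟨μ, fun s => ?_, φ, hφ, hlim⟩
  refine ProbabilityMeasure.eq_of_forall_lipschitz_integral_eq fun f C hC K hK => ?_
  have hf : Measurable f := hK.continuous.measurable
  rw [P.integral_dual s μ hf hC]
  have hconv : ∀ g : E → ℝ, Continuous g → (∀ x, |g x| ≤ C) →
      Tendsto (fun n => ∫ y, g y ∂(P.cesaroProb x (φ n) : Measure E)) atTop
        (𝓝 (∫ y, g y ∂(μ : Measure E))) := fun g hg hgC =>
    ProbabilityMeasure.tendsto_iff_forall_integral_tendsto.1 hlim
      (BoundedContinuousFunction.ofNormedAddCommGroup g hg C hgC)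
  have hPf : Continuous (P.apply s f) :=
    P.feller s (BoundedContinuousFunction.ofNormedAddCommGroup f hK.continuous C hC)
  refine sub_eq_zero.1 (tendsto_nhds_unique
    ((hconv _ hPf (P.abs_apply_le s hC)).sub (hconv f hK.continuous hC)) ?_)
  refine squeeze_zero_norm (fun n => P.abs_integral_apply_cesaro_sub_le s _ x hf hC) ?_
  have h1 : Tendsto (fun n : ℕ => ((n : ℝ) + 1)⁻¹ * (2 * C * s)) atTop (𝓝 0) := by
    simpa using (tendsto_one_div_add_atTop_nhds_zero_nat (𝕜 := ℝ)).mul_const (2 * C * s)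
  refine (h1.comp hφ.tendsto_atTop).congr fun n => ?_
  simp

end KrylovBogoliubov

/-! ### Decay of the asymptotic oscillation -/

section Contraction

variable {E : Type*} [MetricSpace E] [MeasurableSpace E] [BorelSpace E]
  {P : MarkovFellerSemigroup E} {z : E}

/-- The best constant `c` bounding the asymptotic oscillation `limsup_t |P_t f(x) - P_t f(y)|` over
all pairs satisfies `c ≤ q η + (1 - q) c` for every `η > 0`, where `q > 0` bounds below the
probability that two independent copies of the process are simultaneously in a ball around `z` on
which the oscillation is at most `η`. Hence `c = 0`. -/
theorem eventually_abs_apply_sub_apply_le (hz : P.EventuallyContinuousAt z)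
    (hunif : ∀ ε > 0, ∃ m > 0, ∀ x, ∀ᶠ t in atTop, m ≤ (P.kernel t x).real (Metric.ball z ε))
    {f : E → ℝ} {C : ℝ} (hC : ∀ x, |f x| ≤ C) {K : ℝ≥0} (hK : LipschitzWith K f) (x y : E) {ε : ℝ}
    (hε : 0 < ε) : ∀ᶠ t in atTop, |P.apply t f x - P.apply t f y| ≤ ε := by
  have hf : Measurable f := hK.continuous.measurable
  have hC0 : 0 ≤ C := (abs_nonneg _).trans (hC z)
  set S : Set ℝ := {b | 0 ≤ b ∧ ∀ x y, ∀ ε > 0, ∀ᶠ t in atTop,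
    |P.apply t f x - P.apply t f y| ≤ b + ε} with hS
  have hSne : S.Nonempty := ⟨2 * C, by positivity, fun x y ε hε =>
    Eventually.of_forall fun t => (P.abs_apply_sub_apply_le t hC x y).trans (by linarith)⟩
  have hSbdd : BddBelow S := ⟨0, fun b hb => hb.1⟩
  set c := sInf S with hc
  have hc0 : 0 ≤ c := le_csInf hSne fun b hb => hb.1
  have hcS : ∀ x y, ∀ ε > 0, ∀ᶠ t in atTop, |P.apply t f x - P.apply t f y| ≤ c + ε := by
    intro x y ε hε
    obtain ⟨b, hb, hbc⟩ := exists_lt_of_csInf_lt hSne (lt_add_of_pos_right c (half_pos hε))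
    filter_upwards [hb.2 x y (ε / 2) (half_pos hε)] with t ht
    linarith
  have hcη : ∀ η > 0, c ≤ η := by
    intro η hη
    by_contra! hlt
    obtain ⟨δ, hδ, hball⟩ := hz.exists_ball_sub_le hK hC hη
    obtain ⟨m, hm, hmB⟩ := hunif δ hδ
    set B := Metric.ball z δ
    have hB : MeasurableSet B := Metric.isOpen_ball.measurableSet
    have hm1 : m ≤ 1 := by
      obtain ⟨t, ht⟩ := (hmB z).exists
      exact ht.trans measureReal_le_one
    have hmem : c - m ^ 2 * (c - η) ∈ S := by
      refine ⟨?_, fun x y ε hε => ?_⟩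
      · nlinarith [mul_nonneg (sub_nonneg.2 (pow_le_one₀ hm.le hm1 : m ^ 2 ≤ 1))
          (sub_nonneg.2 hlt.le)]
      obtain ⟨s, hsx, hsy⟩ := ((hmB x).and (hmB y)).exists
      refine eventually_atTop_of_add_left s ?_
      set ρ := (P.kernel s x).prod (P.kernel s y)
      have hBB : MeasurableSet (B ×ˢ B) := hB.prod hB
      set b : E × E → ℝ := fun p => c - (B ×ˢ B).indicator (fun _ => c - η) p with hb
      have hbin : ∀ p ∈ B ×ˢ B, b p = η := fun p hp => by
        simp only [hb, Set.indicator_of_mem hp]; ring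
      have hbout : ∀ p ∉ B ×ˢ B, b p = c := fun p hp => by
        simp only [hb, Set.indicator_of_notMem hp]; ring
      have hb0 : ∀ p, 0 ≤ b p ∧ b p ≤ c := fun p => by
        by_cases hp : p ∈ B ×ˢ B
        · rw [hbin p hp]; exact ⟨hη.le, hlt.le⟩
        · rw [hbout p hp]; exact ⟨hc0, le_rfl⟩
      have hbI : ∫ p, b p ∂ρ ≤ c - m ^ 2 * (c - η) := by
        rw [hb, integral_sub (integrable_const _) ((integrable_const _).indicator hBB),
          integral_indicator_const _ hBB, measureReal_prod_prod, smul_eq_mul, integral_const,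
          probReal_univ, one_smul]
        have h1 : m ^ 2 ≤ (P.kernel s x).real B * (P.kernel s y).real B := by
          rw [sq]; exact mul_le_mul hsx hsy hm.le measureReal_nonneg
        have h2 := mul_le_mul_of_nonneg_right h1 (sub_nonneg.2 hlt.le)
        linarith
      have key := eventually_abs_integral_le (ρ := ρ)
        (h := fun t p => P.apply t f p.1 - P.apply t f p.2) (l := atTop) (b := b)
        (fun t => P.measurable_apply_sub_apply t hf)
        (fun t p => P.abs_apply_sub_apply_le t hC p.1 p.2)
        (measurable_const.sub (measurable_const.indicator hBB)) (fun p => (hb0 p).1)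
        (fun p => (hb0 p).2) (Eventually.of_forall fun p ε hε => ?_) hε
      · filter_upwards [key] with t ht
        rw [P.apply_add_sub_apply_add s t hf hC]
        linarith
      · by_cases hp : p ∈ B ×ˢ B
        · rw [hbin p hp]
          filter_upwards [hball p.1 hp.1 p.2 hp.2] with t ht
          linarith
        · rw [hbout p hp]
          exact hcS p.1 p.2 ε hε
    have h1 : c ≤ c - m ^ 2 * (c - η) := csInf_le hSbdd hmem
    have h2 : 0 < m ^ 2 * (c - η) := mul_pos (by positivity) (by linarith)
    linarith
  filter_upwards [hcS x y (ε / 2) (half_pos hε)] with t ht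
  linarith [hcη (ε / 2) (half_pos hε)]

/-- If the oscillation of `P_t f` between any two points vanishes asymptotically for bounded
Lipschitz `f`, then an invariant measure attracts every initial distribution. -/
theorem IsInvariant.isAsymptoticallyStableWith {μ : ProbabilityMeasure E} (hμ : P.IsInvariant μ)
    (h : ∀ (f : E → ℝ) (C : ℝ), (∀ x, |f x| ≤ C) → ∀ K, LipschitzWith K f → ∀ x y, ∀ ε > 0,
      ∀ᶠ t in atTop, |P.apply t f x - P.apply t f y| ≤ ε) :
    P.IsAsymptoticallyStableWith μ := by
  intro ν
  rw [tendsto_iff_forall_lipschitz_integral_tendsto]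
  rintro f ⟨C', hC'⟩ ⟨K, hK⟩
  have hf : Measurable f := hK.continuous.measurable
  obtain ⟨x₀⟩ : Nonempty E := (μ : Measure E).nonempty_of_neZero
  have hC : ∀ x, |f x| ≤ C' + |f x₀| := fun x => by
    have := hC' x x₀
    rw [Real.dist_eq] at this
    linarith [abs_sub_abs_le_abs_sub (f x) (f x₀)]
  refine Metric.tendsto_nhds.2 fun ε hε => ?_
  have key := eventually_abs_integral_le (ρ := (ν : Measure E).prod (μ : Measure E))
    (h := fun (t : ℝ≥0) (q : E × E) => P.apply t f q.1 - P.apply t f q.2) (l := atTop)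
    (b := fun _ => 0) (B := 0) (fun t => P.measurable_apply_sub_apply t hf)
    (fun t q => P.abs_apply_sub_apply_le t hC q.1 q.2) measurable_const (fun _ => le_rfl)
    (fun _ => le_rfl)
    (Eventually.of_forall fun q ε hε => by simpa using h f _ hC K hK q.1 q.2 ε hε) (half_pos hε)
  filter_upwards [key] with t ht
  rw [← P.integral_apply_sub_integral_apply t hf hC, hμ.integral_apply t hf hC, integral_zero,
    ← P.integral_dual t ν hf hC] at ht
  rw [Real.dist_eq]
  linarith

theorem IsInvariant.ball_pos {μ : ProbabilityMeasure E} (hμ : P.IsInvariant μ)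
    (hrec : ∀ x, ∀ ε > 0, ∃ m > 0, ∀ᶠ t in atTop, m ≤ (P.kernel t x).real (Metric.ball z ε))
    {ε : ℝ} (hε : 0 < ε) : 0 < (μ : Measure E) (Metric.ball z ε) := by
  rw [pos_iff_ne_zero]
  intro h0
  have hB : MeasurableSet (Metric.ball z ε) := Metric.isOpen_ball.measurableSet
  have hn : ∀ᵐ x ∂(μ : Measure E), ∀ n : ℕ, P.kernel n x (Metric.ball z ε) = 0 :=
    ae_all_iff.2 fun n => by
      rw [← (hμ.kernel_invariant n).def, Measure.bind_apply hB (Kernel.aemeasurable _),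
        lintegral_eq_zero_iff ((P.kernel n).measurable_coe hB)] at h0
      exact h0
  obtain ⟨x, hx⟩ := hn.exists
  obtain ⟨m, hm, hev⟩ := hrec x ε hε
  obtain ⟨n, hk⟩ := ((tendsto_natCast_atTop_atTop (R := ℝ≥0)).eventually hev).exists
  rw [measureReal_def, hx n] at hk
  exact hk.not_gt (by simpa using hm)

theorem EventuallyContinuousAt.exists_le_kernel_real (hz : P.EventuallyContinuousAt z)
    (hQ : ∀ x : E, ∀ ε : ℝ, 0 < ε →
      0 < limsup (fun t : ℝ≥0 => P.cesaro t x (Metric.ball z ε)) atTop)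
    (hP : ∀ ε : ℝ, 0 < ε → 0 < liminf (fun t : ℝ≥0 => P.kernel t z (Metric.ball z ε)) atTop)
    (x : E) {ε : ℝ} (hε : 0 < ε) :
    ∃ m > 0, ∀ᶠ t in atTop, m ≤ (P.kernel t x).real (Metric.ball z ε) := by
  obtain ⟨δ, hδ, a, ha, hball⟩ := hz.exists_ball_le_kernel_real hP hε
  obtain ⟨t, hQt, ht⟩ := ((frequently_lt_of_lt_limsup (by isBoundedDefault)
    (hQ x δ hδ)).and_eventually (eventually_gt_atTop 0)).exists
  obtain ⟨s, hs⟩ := P.exists_lt_kernel_of_lt_cesaro ht Metric.isOpen_ball.measurableSet hQt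
  have hs' : 0 < (P.kernel s x).real (Metric.ball z δ) :=
    ENNReal.toReal_pos hs.ne' (measure_ne_top _ _)
  exact ⟨_, mul_pos (half_pos ha) hs', P.eventually_mul_le_kernel_real Metric.isOpen_ball.measurableSet
    Metric.isOpen_ball.measurableSet (half_pos ha).le (half_lt_self ha) hs' hball le_rfl⟩

end Contraction

/-! ### Uniform recurrence and asymptotic stability -/

section Stability

variable {E : Type*} [MetricSpace E] [PolishSpace E] [MeasurableSpace E] [BorelSpace E]
  {P : MarkovFellerSemigroup E} {z : E}

/-- When the invariant measure `μ` is unique, the time averages from every `x` accumulate at `μ`,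
so every `x` reaches a ball around `z` with a probability bounded below independently of `x`. -/
theorem EventuallyContinuousAt.exists_forall_le_kernel_real (hz : P.EventuallyContinuousAt z)
    (hT : P.tightPoints = Set.univ)
    (hP : ∀ ε : ℝ, 0 < ε → 0 < liminf (fun t : ℝ≥0 => P.kernel t z (Metric.ball z ε)) atTop)
    {μ : ProbabilityMeasure E} (huniq : ∀ ν, P.IsInvariant ν → ν = μ)
    (hpos : ∀ ε > 0, 0 < (μ : Measure E) (Metric.ball z ε)) {ε : ℝ} (hε : 0 < ε) :
    ∃ m > 0, ∀ x, ∀ᶠ t in atTop, m ≤ (P.kernel t x).real (Metric.ball z ε) := by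
  obtain ⟨δ, hδ, a, ha, hball⟩ := hz.exists_ball_le_kernel_real hP hε
  obtain ⟨c, hc0, hc⟩ := ENNReal.lt_iff_exists_nnreal_btwn.1 (hpos δ hδ)
  have hc0' : (0 : ℝ) < c := by exact_mod_cast hc0
  refine ⟨a / 2 * c, by positivity, fun x => ?_⟩
  obtain ⟨ν, hν, φ, -, hlim⟩ :=
    P.exists_isInvariant_tendsto_cesaroProb (x := x) (hT ▸ Set.mem_univ x)
  obtain rfl := huniq ν hν
  have hliminf := hc.trans_le
    (ProbabilityMeasure.le_liminf_measure_open_of_tendsto hlim Metric.isOpen_ball)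
  obtain ⟨n, hn⟩ := (eventually_lt_of_lt_liminf hliminf).exists
  obtain ⟨s, hs⟩ := P.exists_lt_kernel_of_lt_cesaro (t := φ n + 1) (by positivity)
    Metric.isOpen_ball.measurableSet hn
  have hs' : (c : ℝ) ≤ (P.kernel s x).real (Metric.ball z δ) := by
    have := ENNReal.toReal_mono (measure_ne_top _ _) hs.le
    simpa [measureReal_def] using this
  exact P.eventually_mul_le_kernel_real Metric.isOpen_ball.measurableSet
    Metric.isOpen_ball.measurableSet (half_pos ha).le (half_lt_self ha) hc0' hball hs'

theorem EventuallyContinuousAt.exists_isAsymptoticallyStableWith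
    (hz : P.EventuallyContinuousAt z) (hT : P.tightPoints = Set.univ)
    (hQ : ∀ x : E, ∀ ε : ℝ, 0 < ε →
      0 < limsup (fun t : ℝ≥0 => P.cesaro t x (Metric.ball z ε)) atTop)
    (hP : ∀ ε : ℝ, 0 < ε → 0 < liminf (fun t : ℝ≥0 => P.kernel t z (Metric.ball z ε)) atTop) :
    ∃ μ : ProbabilityMeasure E, P.IsAsymptoticallyStableWith μ ∧
      P.IsInvariant μ ∧ ∀ μ' : ProbabilityMeasure E, P.IsInvariant μ' → μ' = μ := by
  obtain ⟨μ, hμ, -⟩ :=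
    P.exists_isInvariant_tendsto_cesaroProb (x := z) (hT ▸ Set.mem_univ z)
  have hrec : ∀ x, ∀ ε > 0, ∃ m > 0, ∀ᶠ t in atTop,
      m ≤ (P.kernel t x).real (Metric.ball z ε) :=
    fun x ε hε => hz.exists_le_kernel_real hQ hP x hε
  have huniq : ∀ ν, P.IsInvariant ν → ν = μ := fun ν hν =>
    hν.eq_of_eventuallyContinuousAt hz hrec hμ
  refine ⟨μ, hμ.isAsymptoticallyStableWith fun f C hC K hK x y ε hε => ?_, hμ, huniq⟩
  exact eventually_abs_apply_sub_apply_le hz (fun ε hε =>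
    hz.exists_forall_le_kernel_real hT hP huniq (fun ε hε => hμ.ball_pos hrec hε) hε) hC hK x y hε

end Stability

/-! ### Necessity of the conditions -/

section TimeAverages

variable {E : Type*} [TopologicalSpace E] [MeasurableSpace E] (P : MarkovFellerSemigroup E)

theorem dual_dirac (t : ℝ≥0) (x : E) :
    (P.dual t ⟨Measure.dirac x, inferInstance⟩ : Measure E) = P.kernel t x :=
  Measure.dirac_bind (P.kernel t).measurable x

theorem limsup_cesaro_pos_of_liminf_kernel_pos {x : E} {U : Set E} (hU : MeasurableSet U)
    (h : 0 < liminf (fun t : ℝ≥0 => P.kernel t x U) atTop) :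
    0 < limsup (fun t : ℝ≥0 => P.cesaro t x U) atTop := by
  obtain ⟨c, hc0, hc⟩ := ENNReal.lt_iff_exists_nnreal_btwn.1 h
  obtain ⟨T, hT⟩ := eventually_atTop.1 (eventually_lt_of_lt_liminf hc)
  have hhalf : (0 : ℝ≥0∞) < c / 2 := by simpa using hc0.ne'
  refine hhalf.trans_le (le_limsup_of_frequently_le (Eventually.frequently ?_) (by isBoundedDefault))
  -- For `t ≥ 2 T`, at least half of the interval `(0, t]` lies beyond `T`.
  filter_upwards [eventually_ge_atTop (2 * T), eventually_gt_atTop 0] with t ht ht0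
  rw [P.cesaro_apply t x hU]
  have hsub : Set.Ioc (t / 2 : ℝ) t ⊆ Set.Ioc (0 : ℝ) t :=
    Set.Ioc_subset_Ioc_left (by positivity)
  calc (c / 2 : ℝ≥0∞) = (t : ℝ≥0∞)⁻¹ * ∫⁻ _ in Set.Ioc (t / 2 : ℝ) t, (c : ℝ≥0∞) := by
        have h1 : ENNReal.ofReal ((t : ℝ) - t / 2) = t / 2 := by
          rw [sub_half, ENNReal.ofReal_div_of_pos two_pos]
          simp
        simp only [lintegral_const, Measure.restrict_apply MeasurableSet.univ, Set.univ_inter,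
          Real.volume_Ioc, h1]
        rw [mul_left_comm, ← mul_div_assoc, ENNReal.inv_mul_cancel (by simpa using ht0.ne')
          (by simp), mul_one_div]
    _ ≤ (t : ℝ≥0∞)⁻¹ * ∫⁻ s in Set.Ioc (t / 2 : ℝ) t, P.kernel s.toNNReal x U := by
        gcongr 1
        refine setLIntegral_mono' measurableSet_Ioc fun s hs => (hT _ ?_).le
        refine NNReal.le_toNNReal_of_coe_le ?_
        have : (2 * T : ℝ) ≤ t := by exact_mod_cast ht
        linarith [hs.1]
    _ ≤ (t : ℝ≥0∞)⁻¹ * ∫⁻ s in Set.Ioc (0 : ℝ) t, P.kernel s.toNNReal x U := by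
        gcongr 1
        exact lintegral_mono_set hsub

end TimeAverages

section Converse

variable {E : Type*} [MetricSpace E] [MeasurableSpace E] [BorelSpace E]
  {P : MarkovFellerSemigroup E} {μ : ProbabilityMeasure E}

theorem IsAsymptoticallyStableWith.eventuallyContinuousAt (h : P.IsAsymptoticallyStableWith μ)
    (z : E) : P.EventuallyContinuousAt z := by
  rintro f ⟨K, hK⟩ ⟨C, hC⟩
  have hlim : ∀ x, Tendsto (fun t => P.apply t f x) atTop (𝓝 (∫ y, f y ∂(μ : Measure E))) := by
    intro x
    have := ProbabilityMeasure.tendsto_iff_forall_integral_tendsto.1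
      (h ⟨Measure.dirac x, inferInstance⟩)
      (BoundedContinuousFunction.ofNormedAddCommGroup f hK.continuous C hC)
    simp_rw [P.dual_dirac] at this
    exact this
  have h0 : ∀ x, limsup (fun t => ENNReal.ofReal |P.apply t f x - P.apply t f z|) atTop = 0 := by
    intro x
    have := ENNReal.tendsto_ofReal ((hlim x).sub (hlim z)).abs
    simpa using this.limsup_eq
  simp_rw [h0]
  exact limsup_const 0

theorem IsAsymptoticallyStableWith.liminf_kernel_pos (h : P.IsAsymptoticallyStableWith μ) (x : E)
    {U : Set E} (hU : IsOpen U) (hμU : 0 < (μ : Measure E) U) :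
    0 < liminf (fun t : ℝ≥0 => P.kernel t x U) atTop := by
  have := ProbabilityMeasure.le_liminf_measure_open_of_tendsto
    (h ⟨Measure.dirac x, inferInstance⟩) hU
  simp_rw [P.dual_dirac] at this
  exact hμU.trans_le this

end Converse

end MarkovFellerSemigroup

theorem theorem2p2 {E : Type*} [MetricSpace E] [PolishSpace E] [MeasurableSpace E] [BorelSpace E]
    (P : MarkovFellerSemigroup E) (hT : P.tightPoints = Set.univ) :
    (∃ μ : ProbabilityMeasure E, P.IsAsymptoticallyStableWith μ ∧
        P.IsInvariant μ ∧ ∀ μ' : ProbabilityMeasure E, P.IsInvariant μ' → μ' = μ) ↔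
      ∃ z : E, P.EventuallyContinuousAt z ∧
        (∀ x : E, ∀ ε : ℝ, 0 < ε →
          0 < limsup (fun t : ℝ≥0 => P.cesaro t x (Metric.ball z ε)) atTop) ∧
        (∀ ε : ℝ, 0 < ε →
          0 < liminf (fun t : ℝ≥0 => P.kernel t z (Metric.ball z ε)) atTop) := by
  constructor
  · rintro ⟨μ, hμ, -, -⟩
    -- Any point of the support of the limit measure will do.
    obtain ⟨z, hz⟩ := Measure.nonempty_support (IsProbabilityMeasure.ne_zero (μ : Measure E))
    have hball : ∀ ε : ℝ, 0 < ε → 0 < (μ : Measure E) (Metric.ball z ε) := fun ε hε =>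
      Measure.mem_support_iff_forall z |>.1 hz _ (Metric.ball_mem_nhds z hε)
    exact ⟨z, hμ.eventuallyContinuousAt z,
      fun x ε hε => P.limsup_cesaro_pos_of_liminf_kernel_pos
        Metric.isOpen_ball.measurableSet
        (hμ.liminf_kernel_pos x Metric.isOpen_ball (hball ε hε)),
      fun ε hε => hμ.liminf_kernel_pos z Metric.isOpen_ball (hball ε hε)⟩
  · rintro ⟨z, hz, hQ, hP⟩
    exact hz.exists_isAsymptoticallyStableWith hT hQ hP
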